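/- For a real number $k$ let $(F_{k,n})_{n\ge 0}$ be the $k$-Fibonacci sequence, $F_{k,0}=0$, $F_{k,1}=1$, $F_{k,n}=kF_{k,n-1}+F_{k,n-2}$ for $n\ge 2$. For real numbers $k,a,b$ let $(S^{(a,b)}_{k,n})_{n\ge 0}$ be the generalized $k$-FL sequence, $S^{(a,b)}_{k,0}=2b$, $S^{(a,b)}_{k,1}=bk+a$, $S^{(a,b)}_{k,n}=kS^{(a,b)}_{k,n-1}+S^{(a,b)}_{k,n-2}$ for $n\ge 2$. For an integer sequence $\mathcal A=(a_n)_{n\ge 0}$, a prime $p$ is a primitive prime divisor for $a_n$ if $p\mid a_n$ and $p\nmid a_m$ for all $0\le m<n$ with $a_m\ne 0$; the Zsigmondy set $\mathcal Z(\mathcal A)$ is the set of all $n\ge 0$ such that $a_n$ has no primitive prime divisor. Let $k\ge 1$ be an integer. For every integer $N\ge 1$ there is an integer $r=r(N)\ge 1$ with at least $\lfloor N/2\rfloor+1$ positive divisors. For every choice of such integers $r(N)$, $N\ge 1$, put $$a(N)=(-1)^{r}\Bigl(F_{k,r-1}+\frac{k\,F_{k,r}}{2}\Bigr),\qquad b(N)=(-1)^{r+1}\,\frac{F_{k,r}}{2}\qquad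 (r=r(N)).$$ Then for every $N\ge 1$ the sequence $\bigl(S^{(a(N),b(N))}_{k,n}\bigr)_{n\ge 0}$ consists of integers and its Zsigmondy set has at least $N$ elements. Moreover, for the family $\mathcal F=\bigl\{(S^{(a(N),b(N))}_{k,n})_{n\ge 0} : N\ge 1\bigr\}$ of integer sequences, $\sup_{\mathcal A\in\mathcal F}|\mathcal Z(\mathcal A)|$ is infinite, while $\mathcal Z(\mathcal A)$ is finite for every single $\mathcal A\in\mathcal F$. -/

import Mathlib

/-- The `k`-Fibonacci sequence: `F 0 = 0`, `F 1 = 1`, `F n = k * F (n-1) + F (n-2)`. -/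
noncomputable def kFib (k : ℝ) : ℕ → ℝ
  | 0 => 0
  | 1 => 1
  | (n + 2) => k * kFib k (n + 1) + kFib k n

/-- The generalized `k`-FL sequence attached to real numbers `k`, `a`, `b`. -/
noncomputable def genFL (k a b : ℝ) : ℕ → ℝ
  | 0 => 2 * b
  | 1 => b * k + a
  | (n + 2) => k * genFL k a b (n + 1) + genFL k a b n

/-- `p` is a primitive prime divisor for the `n`-th term of the integer sequence `A`. -/
def IsPrimitivePrimeDivisor (A : ℕ → ℤ) (n p : ℕ) : Prop :=
  p.Prime ∧ (p : ℤ) ∣ A n ∧ ∀ m < n, A m ≠ 0 → ¬ (p : ℤ) ∣ A m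

/-- The Zsigmondy set of an integer sequence. -/
def zsigmondySet (A : ℕ → ℤ) : Set ℕ :=
  {n | ¬ ∃ p, IsPrimitivePrimeDivisor A n p}

/-- `(a, b)` is a pair obtained for the parameters `k` and `N`: for some positive integer `r`
with at least `⌊N/2⌋ + 1` positive divisors, `a` and `b` are given by the displayed formulas. -/
def IsObtainedPair (k : ℝ) (N : ℕ) (a b : ℝ) : Prop :=
  ∃ r : ℕ, 1 ≤ r ∧ N / 2 + 1 ≤ r.divisors.card ∧
    a = (-1) ^ r * (kFib k (r - 1) + k * kFib k r / 2) ∧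
    b = (-1) ^ (r + 1) * (kFib k r / 2)

/-- The family of the (integer) sequences `genFL k (a N) (b N)`, with `N` running over the
positive integers. -/
def flFamily (k : ℝ) (a b : ℕ → ℝ) : Set (ℕ → ℤ) :=
  {A | ∃ N : ℕ, 1 ≤ N ∧ ∀ n, (A n : ℝ) = genFL k (a N) (b N) n}

/-! The chosen `a`, `b` make the sequence the `k`-Fibonacci sequence extended to negative indices,
`S_n = F_{n-r}`, and `|F_{-m}| = F_m`. Up to sign its terms are `F_r, ..., F_1, 0, F_1, F_2, ...`.

Many indices are bad. For a proper divisor `d` of `r`, the term at `r - d` is `±F_d`, which divides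
the initial term `±F_r`; the terms at `r + 1, ..., 2r` repeat earlier ones up to sign.

Only finitely many are bad, because `F_n` has a primitive prime divisor for all large `n`. Otherwise
consider `∑ μ(n/d) log F_d`, the logarithm of the primitive part of `F_n`. Each prime dividing `n`
contributes at most `2 log p` and the other primes at most `0`, so the sum is at most `2 log n`.
Binet's formula bounds it below by `φ(n) log α - O(1)`, and `φ(n) ≥ √(n/2)` gives a contradiction.
The contributions rest on how the valuation of `F_m` changes when `m` is multiplied by a prime. -/

/-- The `K`-Fibonacci sequence with natural parameter and natural values. -/
def natKFib (K : ℕ) : ℕ → ℕ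
  | 0 => 0
  | 1 => 1
  | (n + 2) => K * natKFib K (n + 1) + natKFib K n

/-! ### Strong divisibility of the Fibonacci numbers -/

namespace natKFib

theorem add_two (K n : ℕ) : natKFib K (n + 2) = K * natKFib K (n + 1) + natKFib K n := rfl

theorem cast_real (K n : ℕ) : ((natKFib K n : ℕ) : ℝ) = kFib K n := by
  induction n using Nat.twoStepInduction with
  | zero => simp [natKFib, kFib]
  | one => simp [natKFib, kFib]
  | more n h0 h1 => rw [add_two, kFib]; push_cast; rw [h0, h1]

theorem pos {K : ℕ} (hK : 0 < K) : ∀ n : ℕ, 0 < natKFib K (n + 1)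
  | 0 => Nat.one_pos
  | n + 1 => by
    rw [add_two]
    exact Nat.add_pos_left (Nat.mul_pos hK (pos hK n)) _

theorem pos_of_pos {K : ℕ} (hK : 0 < K) {n : ℕ} (hn : 0 < n) : 0 < natKFib K n := by
  obtain ⟨m, rfl⟩ := Nat.exists_eq_succ_of_ne_zero hn.ne'
  exact pos hK m

theorem coprime_succ (K n : ℕ) : (natKFib K n).Coprime (natKFib K (n + 1)) := by
  induction n with
  | zero => simp [natKFib]
  | succ n ih =>
    rw [add_two]
    simpa [Nat.coprime_mul_right_add_right, add_comm] using ih.symm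

theorem add_add_one (K m n : ℕ) : natKFib K (m + n + 1) =
    natKFib K m * natKFib K n + natKFib K (m + 1) * natKFib K (n + 1) := by
  induction n using Nat.twoStepInduction generalizing m with
  | zero => simp [natKFib]
  | one =>
    change natKFib K (m + 2) = _
    simp [natKFib]; ring
  | more n h0 h1 =>
    have e : m + (n + 2) + 1 = (m + n + 1) + 2 := by ring
    rw [e, add_two, show m + n + 1 + 1 = m + (n + 1) + 1 by ring, h0, h1, add_two K n,
      add_two K (n + 1), add_two K n]
    ring

theorem gcd_add_self (K m n : ℕ) :
    (natKFib K m).gcd (natKFib K (n + m)) = (natKFib K m).gcd (natKFib K n) := by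
  rcases n with _ | n
  · simp [natKFib]
  · rw [show n + 1 + m = n + m + 1 by ring, add_add_one, add_comm,
      Nat.gcd_add_mul_right_right (natKFib K m) _ (natKFib K n)]
    exact (coprime_succ K m).symm.gcd_mul_right_cancel_right _

theorem gcd_add_mul_self (K m n j : ℕ) :
    (natKFib K m).gcd (natKFib K (n + j * m)) = (natKFib K m).gcd (natKFib K n) := by
  induction j with
  | zero => simp
  | succ j ih => rw [← ih, add_mul, ← add_assoc, one_mul, gcd_add_self]

theorem gcd_eq (K m n : ℕ) :
    natKFib K (m.gcd n) = (natKFib K m).gcd (natKFib K n) := by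
  induction m, n using Nat.gcd.induction with
  | H0 n => simp [natKFib]
  | H1 m n _ ih =>
    rw [Nat.gcd_rec, ih]
    conv_rhs => rw [← Nat.mod_add_div' n m, gcd_add_mul_self, Nat.gcd_comm]

theorem dvd_of_dvd (K : ℕ) {m n : ℕ} (h : m ∣ n) : natKFib K m ∣ natKFib K n := by
  rwa [← Nat.gcd_eq_left_iff_dvd, ← gcd_eq, Nat.gcd_eq_left_iff_dvd.mpr]

theorem cassini (K n : ℕ) : (natKFib K (n + 2) : ℤ) * natKFib K n - (natKFib K (n + 1) : ℤ) ^ 2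
    = (-1) ^ (n + 1) := by
  induction n with
  | zero => simp [natKFib]
  | succ n ih =>
    rw [add_two K (n + 1), pow_succ (-1 : ℤ) (n + 1), ← ih, add_two]
    push_cast
    ring

/-! ### Valuations under multiplication of the index -/

open QuadraticAlgebra in
theorem omega_pow_succ (K n : ℕ) : (omega : QuadraticAlgebra ℤ 1 K) ^ (n + 1) =
    ⟨natKFib K n, natKFib K (n + 1)⟩ := by
  induction n with
  | zero => ext <;> simp [natKFib]
  | succ n ih =>
    rw [pow_succ, ih]
    ext <;> simp [natKFib]
    ring

open QuadraticAlgebra in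
theorem omega_pow_im (K n : ℕ) :
    ((omega : QuadraticAlgebra ℤ 1 K) ^ n).im = natKFib K n := by
  cases n with
  | zero => simp [natKFib]
  | succ n => rw [omega_pow_succ]

-- Here `ω² = Kω + 1`: expand `(F_{l+1} ω + F_l)^j = ω^{j(l+1)}` by the binomial theorem and compare
-- coefficients of `ω`.
open QuadraticAlgebra in
theorem mul_succ_eq_sum (K j l : ℕ) : natKFib K (j * (l + 1)) =
    ∑ i ∈ Finset.range (j + 1),
      natKFib K (l + 1) ^ i * natKFib K l ^ (j - i) * j.choose i * natKFib K i := by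
  have h : (omega : QuadraticAlgebra ℤ 1 K) ^ (j * (l + 1)) =
      (((natKFib K (l + 1) : ℕ) : QuadraticAlgebra ℤ 1 K) * omega +
        ((natKFib K l : ℕ) : QuadraticAlgebra ℤ 1 K)) ^ j := by
    rw [mul_comm, pow_mul, omega_pow_succ]
    congr 1
    ext <;> simp
  rw [add_pow] at h
  let φ : QuadraticAlgebra ℤ 1 K →+ ℤ :=
    { toFun := QuadraticAlgebra.im, map_zero' := rfl, map_add' := fun _ _ => rfl }
  have h' := congrArg φ h
  rw [map_sum] at h'
  have h2 : (natKFib K (j * (l + 1)) : ℤ) = ∑ i ∈ Finset.range (j + 1),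
      (natKFib K (l + 1) : ℤ) ^ i * natKFib K l ^ (j - i) * j.choose i * natKFib K i := by
    rw [← omega_pow_im]
    refine h'.trans (Finset.sum_congr rfl fun i _ => ?_)
    rw [← omega_pow_im K i]
    have e : ((natKFib K (l + 1) : QuadraticAlgebra ℤ 1 K) * omega) ^ i *
        (natKFib K l : QuadraticAlgebra ℤ 1 K) ^ (j - i) * (j.choose i : QuadraticAlgebra ℤ 1 K) =
        ((natKFib K (l + 1) ^ i * natKFib K l ^ (j - i) * j.choose i : ℤ)) •
          (omega : QuadraticAlgebra ℤ 1 K) ^ i := by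
      rw [zsmul_eq_mul]; push_cast; ring
    rw [e]
    exact im_smul _ _
  exact_mod_cast h2

/-- Multiplying the index by `j`, modulo the square of the term. -/
theorem mul_succ_eq (K j l : ℕ) (hj : 1 ≤ j) : ∃ T, natKFib K (j * (l + 1)) =
    natKFib K (l + 1) * (j * natKFib K l ^ (j - 1) + T) ∧
    natKFib K (l + 1) * T = ∑ i ∈ Finset.Ico 2 (j + 1),
      natKFib K (l + 1) ^ i * natKFib K l ^ (j - i) * j.choose i * natKFib K i := by
  have hd : natKFib K (l + 1) ∣ ∑ i ∈ Finset.Ico 2 (j + 1),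
      natKFib K (l + 1) ^ i * natKFib K l ^ (j - i) * j.choose i * natKFib K i := by
    refine Finset.dvd_sum fun i hi => ?_
    rw [Finset.mem_Ico] at hi
    exact (((dvd_pow_self _ (by omega)).mul_right _).mul_right _).mul_right _
  obtain ⟨T, hT⟩ := hd
  refine ⟨T, ?_, hT.symm⟩
  rw [mul_succ_eq_sum, mul_add, ← hT, Finset.range_eq_Ico,
    Finset.sum_eq_sum_Ico_succ_bot (by omega), Finset.sum_eq_sum_Ico_succ_bot (by omega)]
  simp [natKFib]
  ring

/-- With `m = l + 1`, the quotient `F_{qm} / F_m` is `q F_l^{q-1}` modulo `p`, a unit since `F_l` is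
coprime to `F_m`. -/
theorem mul_prime_of_ne {K : ℕ} (hK : 0 < K) {p q m : ℕ} (hp : p.Prime) (hq : q.Prime)
    (hm : 0 < m) (hpm : p ∣ natKFib K m) (hpq : p ≠ q) :
    (natKFib K (q * m)).factorization p = (natKFib K m).factorization p := by
  obtain ⟨l, rfl⟩ := Nat.exists_eq_succ_of_ne_zero hm.ne'
  have h0 := (pos hK l).ne'
  obtain ⟨T, hT, hT'⟩ := mul_succ_eq K q l hq.one_le
  have hpT : p ∣ T := by
    refine Nat.dvd_of_mul_dvd_mul_left (pos hK l) ?_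
    rw [hT']
    refine Finset.dvd_sum fun i hi => ?_
    rw [Finset.mem_Ico] at hi
    refine ((Dvd.dvd.mul_right ?_ _).mul_right _).mul_right _
    obtain ⟨s, rfl⟩ := Nat.exists_eq_add_of_le hi.1
    rw [pow_add, pow_two]
    exact (mul_dvd_mul_left _ hpm).mul_right _
  have hpl : ¬ p ∣ natKFib K l := fun h =>
    hp.one_lt.ne' (Nat.dvd_one.mp ((coprime_succ K l) ▸ Nat.dvd_gcd h hpm))
  have hc : ¬ p ∣ q * natKFib K l ^ (q - 1) + T := by
    rw [Nat.dvd_add_iff_left hpT |>.symm]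
    intro h
    rcases hp.dvd_mul.mp h with h | h
    · exact hpq ((Nat.prime_dvd_prime_iff_eq hp hq).mp h)
    · exact hpl (hp.dvd_of_dvd_pow h)
  have hc0 : q * natKFib K l ^ (q - 1) + T ≠ 0 := fun h => hc (h ▸ dvd_zero p)
  rw [Nat.succ_eq_add_one, hT, Nat.factorization_mul h0 hc0]
  simp [Nat.factorization_eq_zero_of_not_dvd hc]

/-- The hypothesis says `(x + kf)² - (k² + 4)f² = ±1`. If `4` divided `x + kf`, then `(k² + 4)f²`
would be `±1` modulo `8`; but it is `5` for odd `k`, `f` and even otherwise. -/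
theorem mod_eight (k x f : ZMod 8) (h : x ^ 2 + 2 * k * f * x - 4 * f ^ 2 = 1 ∨
    x ^ 2 + 2 * k * f * x - 4 * f ^ 2 = -1) : 2 * (x + k * f) ≠ 0 := by
  revert k x f
  decide

theorem not_pow_three_dvd_two {K l : ℕ} (h : 2 ∣ natKFib K (l + 1)) :
    ¬ 8 ∣ 2 * natKFib K l + K * natKFib K (l + 1) := by
  obtain ⟨f, hf⟩ := h
  intro h8
  rw [hf] at h8
  have hc := cassini K l
  rw [add_two, hf] at hc
  have hc' := congrArg (Int.cast : ℤ → ZMod 8) hc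
  push_cast at hc'
  refine mod_eight K (natKFib K l) f ?_ ?_
  · rcases neg_one_pow_eq_or (ZMod 8) (l + 1) with h | h <;> rw [h] at hc'
    · left; rw [← hc']; ring
    · right; rw [← hc']; ring
  · have := (ZMod.natCast_eq_zero_iff _ 8).mpr h8
    push_cast at this
    rw [← this]; ring

/-- The quotient is `p F_l^{p-1} + T`. For odd `p`, `p² ∣ T`, so even `p²` does not divide it; the
weaker bound `2` accommodates `p = 2`, settled by Cassini's identity modulo `8`. -/
theorem factorization_mul_self_le {K : ℕ} (hK : 0 < K) {p m : ℕ} (hp : p.Prime)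
    (hm : 0 < m) (hpm : p ∣ natKFib K m) :
    (natKFib K (p * m)).factorization p ≤ (natKFib K m).factorization p + 2 := by
  obtain ⟨l, rfl⟩ := Nat.exists_eq_succ_of_ne_zero hm.ne'
  have h0 := (pos hK l).ne'
  obtain ⟨T, hT, hT'⟩ := mul_succ_eq K p l hp.one_le
  have hpl : ¬ p ∣ natKFib K l := fun h =>
    hp.one_lt.ne' (Nat.dvd_one.mp ((coprime_succ K l) ▸ Nat.dvd_gcd h hpm))
  have hc : ¬ p ^ 3 ∣ p * natKFib K l ^ (p - 1) + T := by
    rcases hp.eq_two_or_odd with rfl | hodd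
    · have : T = K * natKFib K (l + 1) := by
        refine Nat.eq_of_mul_eq_mul_left (pos hK l) ?_
        rw [hT']
        simp [natKFib]
        ring
      rw [this]
      simpa using not_pow_three_dvd_two hpm
    · have hp3 : 3 ≤ p := by
        have := hp.two_le
        omega
      have hpT : p ^ 2 ∣ T := by
        refine Nat.dvd_of_mul_dvd_mul_left (pos hK l) ?_
        rw [hT']
        refine Finset.dvd_sum fun i hi => ?_
        rw [Finset.mem_Ico] at hi
        refine Dvd.dvd.mul_right ?_ _
        -- For `i < p` one factor `p` comes from the binomial coefficient; for `i = p ≥ 3` both come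
        -- from `F_{l+1}^3`.
        rcases Nat.lt_succ_iff_lt_or_eq.mp hi.2 with hip | rfl
        · obtain ⟨s, rfl⟩ := Nat.exists_eq_add_of_le hi.1
          rw [mul_right_comm]
          refine Dvd.dvd.mul_right ?_ _
          rw [pow_two p, ← mul_assoc]
          refine mul_dvd_mul ?_ (hp.dvd_choose_self (by omega) hip)
          rw [pow_add, pow_two]
          exact (mul_dvd_mul_left _ hpm).mul_right _
        · refine (Dvd.dvd.mul_right ?_ _).mul_right _
          obtain ⟨s, hs⟩ := Nat.exists_eq_add_of_le hp3
          rw [show natKFib K (l + 1) ^ i = natKFib K (l + 1) * natKFib K (l + 1) ^ 2 *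
            natKFib K (l + 1) ^ s by rw [← pow_succ', ← pow_add, ← hs]]
          exact (mul_dvd_mul_left _ (pow_dvd_pow_of_dvd hpm 2)).mul_right _
      intro h
      have h2 : p ^ 2 ∣ p * natKFib K l ^ (p - 1) :=
        (Nat.dvd_add_iff_left hpT).mpr ((pow_dvd_pow p (by norm_num)).trans h)
      rw [pow_two] at h2
      exact hpl (hp.dvd_of_dvd_pow (Nat.dvd_of_mul_dvd_mul_left hp.pos h2))
  have hc0 : p * natKFib K l ^ (p - 1) + T ≠ 0 := fun h => hc (h ▸ dvd_zero _)
  rw [Nat.succ_eq_add_one, hT, Nat.factorization_mul h0 hc0]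
  have := mt (hp.pow_dvd_iff_le_factorization hc0).mpr hc
  simp only [Finsupp.coe_add, Pi.add_apply]
  omega

end natKFib

/-! ### Rank of apparition and the upper bound for the Möbius sum -/

namespace natKFib

theorem exists_rank {K p n : ℕ} (hn : 0 < n) (hp : p ∣ natKFib K n) :
    ∃ z, 0 < z ∧ ∀ m, p ∣ natKFib K m ↔ z ∣ m := by
  classical
  have hex : ∃ z, 0 < z ∧ p ∣ natKFib K z := ⟨n, hn, hp⟩
  refine ⟨Nat.find hex, (Nat.find_spec hex).1, fun m => ⟨fun h => ?_, fun h => ?_⟩⟩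
  · have hz := Nat.find_spec hex
    have hg : p ∣ natKFib K ((Nat.find hex).gcd m) := by
      rw [gcd_eq]
      exact Nat.dvd_gcd hz.2 h
    have hle := Nat.find_min' hex ⟨Nat.gcd_pos_of_pos_left m hz.1, hg⟩
    exact Nat.gcd_eq_left_iff_dvd.mp
      (le_antisymm (Nat.le_of_dvd hz.1 (Nat.gcd_dvd_left _ _)) hle)
  · exact (Nat.find_spec hex).2.trans (dvd_of_dvd K h)

theorem factorization_mul_of_not_dvd {K : ℕ} (hK : 0 < K) {p m : ℕ} (hp : p.Prime)
    (hm : 0 < m) (hpm : p ∣ natKFib K m) (M : ℕ) (hM : ¬ p ∣ M) :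
    (natKFib K (M * m)).factorization p = (natKFib K m).factorization p := by
  induction M using induction_on_primes with
  | zero => simp at hM
  | one => simp
  | prime_mul q a hq ih =>
    have ha : a ≠ 0 := by rintro rfl; simp at hM
    have hqp : p ≠ q := by rintro rfl; exact hM (dvd_mul_right _ _)
    rw [mul_assoc, mul_prime_of_ne hK hp hq (Nat.mul_pos (Nat.pos_of_ne_zero ha) hm)
      (hpm.trans (dvd_of_dvd K (dvd_mul_left _ _))) hqp]
    exact ih fun h => hM (h.mul_left q)

end natKFib

theorem filter_divisors_eq_image_mul_pow {p z m : ℕ} (hp : p.Prime) (hz : 0 < z) (hm : 0 < m)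
    (hzm : z ∣ m) :
    m.divisors.filter (fun d => d = z * p ^ (d.factorization p - z.factorization p)) =
      (Finset.range (m.factorization p - z.factorization p + 1)).image (fun i => z * p ^ i) := by
  have hfac : ∀ i, (z * p ^ i).factorization p = z.factorization p + i := fun i => by
    rw [Nat.factorization_mul hz.ne' (pow_ne_zero _ hp.ne_zero)]
    simp [hp.factorization]
  ext d
  simp only [Finset.mem_filter, Nat.mem_divisors, Finset.mem_image, Finset.mem_range]
  constructor
  · rintro ⟨⟨hd, -⟩, he⟩
    refine ⟨_, ?_, he.symm⟩
    have := (Nat.factorization_le_iff_dvd (ne_zero_of_dvd_ne_zero hm.ne' hd) hm.ne').mpr hd p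
    omega
  · rintro ⟨i, hi, rfl⟩
    refine ⟨⟨?_, hm.ne'⟩, by rw [hfac]; simp⟩
    obtain ⟨M, rfl⟩ := hzm
    have hM : M ≠ 0 := by rintro rfl; simp at hm
    refine mul_dvd_mul_left _ ((hp.pow_dvd_iff_le_factorization hM).mpr ?_)
    rw [Nat.factorization_mul hz.ne' hM] at hi
    simp only [Finsupp.coe_add, Pi.add_apply] at hi
    omega

namespace natKFib

-- With `z` the rank of apparition of `p`, `v_p(F_m)` is the divisor sum of a function `H` supported
-- on the numbers `z p^i`, where it is the increment of the valuation. Möbius inversion turns the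
-- sum into `H n`, and non-primitivity (`z < n`) excludes `i = 0`.
open ArithmeticFunction in
theorem sum_moebius_factorization_le {K : ℕ} (hK : 0 < K) {p n : ℕ} (hp : p.Prime)
    (hn : 0 < n) (hpn : p ∣ natKFib K n) (h : ∃ j, 0 < j ∧ j < n ∧ p ∣ natKFib K j) :
    ∑ x ∈ n.divisorsAntidiagonal,
      (moebius x.1 : ℝ) * ((natKFib K x.2).factorization p : ℝ) ≤ if p ∣ n then 2 else 0 := by
  obtain ⟨z, hz, hzp⟩ := exists_rank hn hpn
  obtain ⟨j, hj, hjn, hpj⟩ := h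
  have hzn : z < n := (Nat.le_of_dvd hj ((hzp j).mp hpj)).trans_lt hjn
  let f : ℕ → ℝ := fun m => ((natKFib K m).factorization p : ℝ)
  let δ : ℕ → ℝ := fun i => if i = 0 then f z else f (z * p ^ i) - f (z * p ^ (i - 1))
  let e : ℕ → ℕ := fun d => d.factorization p - z.factorization p
  let H : ℕ → ℝ := fun d => if d = z * p ^ e d then δ (e d) else 0
  have he : ∀ i, e (z * p ^ i) = i := fun i => by
    simp only [e]
    rw [Nat.factorization_mul hz.ne' (pow_ne_zero _ hp.ne_zero)]
    simp [hp.factorization]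
  have hδ : ∀ i, ∑ i ∈ Finset.range (i + 1), δ i = f (z * p ^ i) := fun i => by
    induction i with
    | zero => simp [δ]
    | succ i ih => rw [Finset.sum_range_succ, ih]; simp [δ]
  have hH : ∀ m > 0, ∑ d ∈ m.divisors, H d = f m := by
    intro m hm
    by_cases hzm : z ∣ m
    · rw [← Finset.sum_filter, filter_divisors_eq_image_mul_pow hp hz hm hzm,
        Finset.sum_image (fun a _ b _ hab => by
          rw [← he a, ← he b]; exact congrArg e hab),
        Finset.sum_congr rfl (fun i _ => by rw [he i]), hδ]
      obtain ⟨M, rfl⟩ := hzm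
      have hM : M ≠ 0 := by rintro rfl; simp at hm
      have hfe : (z * M).factorization p - z.factorization p = M.factorization p := by
        rw [Nat.factorization_mul hz.ne' hM]; simp
      rw [hfe]
      have hpow : M = p ^ M.factorization p * (M / p ^ M.factorization p) :=
        (Nat.ordProj_mul_ordCompl_eq_self M p).symm
      conv_rhs => rw [hpow, ← mul_assoc, mul_comm]
      simp only [f]
      rw [factorization_mul_of_not_dvd hK hp (Nat.mul_pos hz (pow_pos hp.pos _))
        ((hzp _).mpr (dvd_mul_right _ _)) _ (Nat.not_dvd_ordCompl hp hM)]
    · have h0 : f m = 0 := by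
        simp only [f, Nat.factorization_eq_zero_of_not_dvd (mt (hzp m).mp hzm), Nat.cast_zero]
      rw [h0]
      refine Finset.sum_eq_zero fun d hd => if_neg fun hd' => hzm ?_
      exact (Dvd.intro _ hd'.symm).trans (Nat.dvd_of_mem_divisors hd)
  rw [sum_eq_iff_sum_mul_moebius_eq.mp hH n hn]
  simp only [H]
  split_ifs with h1 h2 h2
  · have hi : e n ≠ 0 := fun h0 => by rw [h0] at h1; simp at h1; omega
    obtain ⟨i, hi⟩ := Nat.exists_eq_succ_of_ne_zero hi
    rw [hi]
    simp only [δ, Nat.succ_eq_add_one, Nat.add_one_ne_zero, if_false, Nat.add_sub_cancel, f]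
    have := factorization_mul_self_le hK hp (Nat.mul_pos hz (pow_pos hp.pos i))
      ((hzp _).mpr (dvd_mul_right z (p ^ i)))
    rw [show p * (z * p ^ i) = z * p ^ (i + 1) by ring] at this
    rw [sub_le_iff_le_add']
    exact_mod_cast this
  · exact absurd (by
      rw [h1]
      refine Dvd.dvd.mul_left (dvd_pow_self p fun h0 => ?_) z
      rw [h0] at h1; simp at h1; omega) h2
  · norm_num
  · exact le_rfl

open ArithmeticFunction in
theorem sum_moebius_log_le {K : ℕ} (hK : 0 < K) {n : ℕ} (hn : 0 < n)
    (h : ∀ p, p.Prime → p ∣ natKFib K n → ∃ j, 0 < j ∧ j < n ∧ p ∣ natKFib K j) :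
    ∑ x ∈ n.divisorsAntidiagonal, (moebius x.1 : ℝ) * Real.log (natKFib K x.2) ≤
      2 * Real.log n := by
  have hF := (pos_of_pos hK hn).ne'
  have hlog : ∀ x ∈ n.divisorsAntidiagonal, (moebius x.1 : ℝ) * Real.log (natKFib K x.2) =
      ∑ p ∈ (natKFib K n).primeFactors,
        (moebius x.1 : ℝ) * ((natKFib K x.2).factorization p : ℝ) * Real.log p := by
    intro x hx
    have hx2 : x.2 ∣ n := Dvd.intro_left _ (Nat.mem_divisorsAntidiagonal.mp hx).1
    rw [Real.log_nat_eq_sum_factorization, Finsupp.sum_of_support_subset _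
      (s := (natKFib K n).primeFactors) (by
        rw [Nat.support_factorization]
        exact Nat.primeFactors_mono (dvd_of_dvd K hx2) hF) _ (by simp), Finset.mul_sum]
    simp only [mul_assoc]
  rw [Finset.sum_congr rfl hlog, Finset.sum_comm]
  calc _ = ∑ p ∈ (natKFib K n).primeFactors, (∑ x ∈ n.divisorsAntidiagonal,
        (moebius x.1 : ℝ) * ((natKFib K x.2).factorization p : ℝ)) * Real.log p := by
        simp only [Finset.sum_mul]
    _ ≤ ∑ p ∈ (natKFib K n).primeFactors, (if p ∣ n then 2 else 0) * Real.log p := by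
        refine Finset.sum_le_sum fun p hp => ?_
        have hp' := Nat.prime_of_mem_primeFactors hp
        have hd := Nat.dvd_of_mem_primeFactors hp
        exact mul_le_mul_of_nonneg_right
          (sum_moebius_factorization_le hK hp' hn hd (h p hp' hd)) (Real.log_natCast_nonneg p)
    _ = ∑ p ∈ (natKFib K n).primeFactors.filter (· ∣ n), 2 * Real.log p := by
        rw [Finset.sum_filter]
        exact Finset.sum_congr rfl fun p _ => by split_ifs <;> simp
    _ ≤ ∑ p ∈ n.primeFactors, 2 * Real.log p := by
        refine Finset.sum_le_sum_of_subset_of_nonneg (fun p hp => ?_)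
          fun p _ _ => mul_nonneg zero_le_two (Real.log_natCast_nonneg p)
        rw [Finset.mem_filter] at hp
        exact Nat.mem_primeFactors.mpr ⟨Nat.prime_of_mem_primeFactors hp.1, hp.2, hn.ne'⟩
    _ = 2 * Real.log (∏ p ∈ n.primeFactors, p : ℕ) := by
        rw [← Finset.mul_sum, Nat.cast_prod, Real.log_prod fun p hp =>
          Nat.cast_ne_zero.mpr (Nat.prime_of_mem_primeFactors hp).ne_zero]
    _ ≤ 2 * Real.log n := by
        have h1 := Nat.le_of_dvd hn (Nat.prod_primeFactors_dvd n)
        have h2 : 0 < ∏ p ∈ n.primeFactors, p :=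
          Finset.prod_pos fun p hp => (Nat.prime_of_mem_primeFactors hp).pos
        gcongr

end natKFib

/-! ### Lower bound for the Möbius sum -/

open ArithmeticFunction in
theorem sum_moebius_divisorsAntidiagonal {n : ℕ} (hn : 1 < n) :
    ∑ x ∈ n.divisorsAntidiagonal, (moebius x.1 : ℝ) = 0 := by
  have h : ∀ m > 0, ∑ i ∈ m.divisors, (if i = 1 then (1 : ℝ) else 0) = 1 := fun m hm => by
    simp [hm.ne']
  have := sum_eq_iff_sum_mul_moebius_eq.mp h n (by omega)
  simpa [hn.ne'] using this

open ArithmeticFunction in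
theorem sum_moebius_mul_eq_totient {n : ℕ} (hn : 0 < n) :
    ∑ x ∈ n.divisorsAntidiagonal, (moebius x.1 : ℝ) * (x.2 : ℝ) = n.totient := by
  have h : ∀ m : ℕ, m > 0 → ∑ i ∈ m.divisors, (i.totient : ℝ) = (m : ℝ) := fun m _ => by
    exact_mod_cast Nat.sum_totient m
  exact sum_eq_iff_sum_mul_moebius_eq.mp h n hn

open ArithmeticFunction in
/-- A sequence geometrically close to a linear one has Möbius sums close to multiples of the
totient. -/
theorem totient_mul_sub_le_sum_moebius {g : ℕ → ℝ} {L c C s : ℝ} (hs0 : 0 ≤ s) (hs1 : s < 1)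
    (hC : 0 ≤ C) (hg : ∀ m, 0 < m → |g m - (m * L - c)| ≤ C * s ^ m) {n : ℕ} (hn : 1 < n) :
    n.totient * L - C * (1 - s)⁻¹ ≤
      ∑ x ∈ n.divisorsAntidiagonal, (moebius x.1 : ℝ) * g x.2 := by
  have h1 : ∑ x ∈ n.divisorsAntidiagonal, (moebius x.1 : ℝ) * g x.2 =
      n.totient * L + ∑ x ∈ n.divisorsAntidiagonal,
        (moebius x.1 : ℝ) * (g x.2 - (x.2 * L - c)) := by
    have h0 := sum_moebius_divisorsAntidiagonal hn
    rw [← sum_moebius_mul_eq_totient (by omega : 0 < n), Finset.sum_mul,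
      ← sub_eq_zero, ← sub_sub, ← Finset.sum_sub_distrib, ← Finset.sum_sub_distrib]
    -- The constant `c` drops out because `∑ μ = 0` for `n > 1`.
    calc _ = ∑ x ∈ n.divisorsAntidiagonal, (moebius x.1 : ℝ) * (-c) :=
          Finset.sum_congr rfl fun x _ => by ring
      _ = 0 := by rw [← Finset.sum_mul, h0, zero_mul]
  have h2 : |∑ x ∈ n.divisorsAntidiagonal, (moebius x.1 : ℝ) * (g x.2 - (x.2 * L - c))| ≤
      C * (1 - s)⁻¹ := by
    calc _ ≤ ∑ x ∈ n.divisorsAntidiagonal, |(moebius x.1 : ℝ) * (g x.2 - (x.2 * L - c))| :=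
          Finset.abs_sum_le_sum_abs _ _
      _ ≤ ∑ x ∈ n.divisorsAntidiagonal, C * s ^ x.2 := by
          refine Finset.sum_le_sum fun x hx => ?_
          have hx2 : 0 < x.2 := Nat.pos_of_ne_zero (Nat.ne_zero_of_mem_divisorsAntidiagonal hx).2
          rw [abs_mul]
          have hmu : |(moebius x.1 : ℝ)| ≤ 1 := by exact_mod_cast abs_moebius_le_one
          calc _ ≤ 1 * |g x.2 - (x.2 * L - c)| :=
                mul_le_mul_of_nonneg_right hmu (abs_nonneg _)
            _ ≤ _ := by rw [one_mul]; exact hg _ hx2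
      _ = C * ∑ d ∈ n.divisors, s ^ d := by
          rw [← Finset.mul_sum, Nat.sum_divisorsAntidiagonal' (fun _ d => s ^ d)]
      _ ≤ C * (1 - s)⁻¹ := by
          refine mul_le_mul_of_nonneg_left ?_ hC
          rw [← tsum_geometric_of_lt_one hs0 hs1]
          exact (summable_geometric_of_lt_one hs0 hs1).sum_le_tsum _ fun i _ => pow_nonneg hs0 i
  have := (abs_le.mp h2).1
  rw [h1]
  linarith

theorem natKFib_binet {K : ℕ} {α : ℝ} (hα : 0 < α) (h : α ^ 2 = K * α + 1) (n : ℕ) :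
    (natKFib K n : ℝ) * (α + α⁻¹) = α ^ n - (-α⁻¹) ^ n := by
  have h' : (-α⁻¹) ^ 2 = K * (-α⁻¹) + 1 := by
    field_simp
    linarith
  induction n using Nat.twoStepInduction with
  | zero => simp [natKFib]
  | one => simp [natKFib]
  | more n h0 h1 =>
    rw [natKFib.add_two, pow_add α, pow_add (-α⁻¹), h, h']
    push_cast
    rw [pow_succ, pow_succ] at h1
    linear_combination h0 + K * h1

theorem exists_log_natKFib_approx {K : ℕ} (hK : 0 < K) : ∃ L c C s : ℝ, 0 < L ∧ 0 ≤ s ∧ s < 1 ∧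
    0 ≤ C ∧ ∀ m, 0 < m → |Real.log (natKFib K m) - (m * L - c)| ≤ C * s ^ m := by
  have hK' : (1 : ℝ) ≤ K := by exact_mod_cast hK
  let α : ℝ := (K + √(K ^ 2 + 4)) / 2
  have hsq : √((K : ℝ) ^ 2 + 4) ^ 2 = K ^ 2 + 4 := Real.sq_sqrt (by positivity)
  have hsq1 : 2 ≤ √((K : ℝ) ^ 2 + 4) := Real.le_sqrt_of_sq_le (by nlinarith)
  have hα1 : 1 < α := by simp only [α]; linarith
  have hα : 0 < α := by linarith
  have h : α ^ 2 = K * α + 1 := by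
    simp only [α]
    linear_combination hsq / 4
  have hs1 : α⁻¹ ^ 2 < 1 := pow_lt_one₀ (by positivity) (inv_lt_one_of_one_lt₀ hα1) (by norm_num)
  have hs1' : 0 < 1 - α⁻¹ ^ 2 := by linarith
  refine ⟨Real.log α, Real.log (α + α⁻¹), (1 - α⁻¹ ^ 2)⁻¹, α⁻¹ ^ 2, Real.log_pos hα1,
    by positivity, hs1, by positivity, fun m hm => ?_⟩
  have habs : |(-α⁻¹ ^ 2) ^ m| = (α⁻¹ ^ 2) ^ m := by
    rw [abs_pow, abs_neg, abs_of_pos (by positivity)]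
  have hle : (α⁻¹ ^ 2) ^ m ≤ α⁻¹ ^ 2 := pow_le_of_le_one (by positivity) hs1.le hm.ne'
  have hlt : |(-α⁻¹ ^ 2) ^ m| < 1 := by rw [habs]; linarith
  have hpos : 0 < 1 - (-α⁻¹ ^ 2) ^ m := by linarith [(abs_lt.mp hlt).2]
  have hF : (0 : ℝ) < natKFib K m := by exact_mod_cast natKFib.pos_of_pos hK hm
  have hb : (natKFib K m : ℝ) * (α + α⁻¹) = α ^ m * (1 - (-α⁻¹ ^ 2) ^ m) := by
    rw [natKFib_binet hα h, mul_sub, ← mul_pow, mul_one]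
    congr 2
    field_simp
  have hl := congrArg Real.log hb
  rw [Real.log_mul hF.ne' (by positivity), Real.log_mul (by positivity) hpos.ne',
    Real.log_pow] at hl
  have e : Real.log (natKFib K m) - (m * Real.log α - Real.log (α + α⁻¹)) =
      Real.log (1 - (-α⁻¹ ^ 2) ^ m) := by linarith
  rw [e]
  -- The Taylor bound of order zero: `|log (1 - x)| ≤ |x| / (1 - |x|)`.
  have := Real.abs_log_sub_add_sum_range_le hlt 0
  simp only [Finset.range_zero, Finset.sum_empty, zero_add, pow_one] at this
  rw [habs] at this
  refine this.trans ?_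
  rw [div_eq_inv_mul]
  gcongr

/-- For odd `n` multiplicativity reduces to `p ≤ (p - 1)²` for `p ≥ 3`; the prime `2` costs the
factor `2`. -/
theorem le_two_mul_totient_sq (n : ℕ) : n ≤ 2 * n.totient ^ 2 := by
  have hodd : ∀ n : ℕ, ¬ 2 ∣ n → n ≤ n.totient ^ 2 := by
    intro n
    induction n using Nat.recOnPosPrimePosCoprime with
    | prime_pow p k hp hk =>
      intro h2
      have hp3 : 3 ≤ p := by
        have := hp.two_le
        have : p ≠ 2 := by rintro rfl; exact h2 (dvd_pow_self _ hk.ne')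
        omega
      obtain ⟨k, rfl⟩ := Nat.exists_eq_succ_of_ne_zero hk.ne'
      obtain ⟨q, rfl⟩ := Nat.exists_eq_add_of_le hp3
      rw [Nat.totient_prime_pow_succ hp, show 3 + q - 1 = q + 2 by omega, mul_pow, pow_succ]
      refine Nat.mul_le_mul ?_ (by nlinarith)
      exact Nat.le_self_pow (by norm_num) _
    | zero => simp
    | one => simp
    | coprime a b ha hb hab iha ihb =>
      intro h2
      rw [Nat.totient_mul hab, mul_pow]
      exact Nat.mul_le_mul (iha fun h => h2 (h.mul_right b)) (ihb fun h => h2 (h.mul_left a))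
  rcases Nat.eq_zero_or_pos n with rfl | hn
  · simp
  obtain ⟨k, m, hm, rfl⟩ := Nat.exists_eq_two_pow_mul_odd hn.ne'
  have h2 : ¬ 2 ∣ m := hm.not_two_dvd_nat
  have hm' := hodd m h2
  rcases k with _ | k
  · simp; omega
  · rw [Nat.totient_mul (Nat.Coprime.pow_left _ (Nat.coprime_two_left.mpr hm)),
      Nat.totient_prime_pow_succ Nat.prime_two, mul_pow]
    have h1 : 2 ^ k ≤ (2 ^ k) ^ 2 := Nat.le_self_pow (by norm_num) _
    calc 2 ^ (k + 1) * m = 2 * (2 ^ k * m) := by ring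
      _ ≤ 2 * ((2 ^ k) ^ 2 * m.totient ^ 2) := by gcongr
      _ = _ := by ring

theorem eventually_two_mul_log_lt {L D : ℝ} (hL : 0 < L) :
    ∀ᶠ n : ℕ in Filter.atTop, 2 * Real.log n < n.totient * L - D := by
  have h1 : (fun x : ℝ => 2 * Real.log x + D) =o[Filter.atTop] fun x : ℝ => x ^ (1 / 2 : ℝ) :=
    ((isLittleO_log_rpow_atTop (by norm_num)).const_mul_left 2).add
      (Asymptotics.isLittleO_const_left.mpr (Or.inr (by
        refine Filter.tendsto_abs_atTop_atTop.comp (tendsto_rpow_atTop (by norm_num)))))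
  have h2 := tendsto_natCast_atTop_atTop.eventually
    (h1.bound (show (0 : ℝ) < L / 4 by positivity))
  filter_upwards [h2, Filter.eventually_gt_atTop 0] with n hn hn0
  have hn' : (0 : ℝ) < n := by exact_mod_cast hn0
  rw [← Real.sqrt_eq_rpow, Real.norm_of_nonneg (Real.sqrt_nonneg _)] at hn
  have h3 := (le_abs_self _).trans hn
  have h4 : √(n : ℝ) ≤ 2 * n.totient := by
    rw [Real.sqrt_le_left (by positivity)]
    have : (n : ℝ) ≤ 2 * (n.totient : ℝ) ^ 2 := by exact_mod_cast le_two_mul_totient_sq n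
    nlinarith [sq_nonneg (n.totient : ℝ)]
  have h5 : 0 < √(n : ℝ) := Real.sqrt_pos.mpr hn'
  nlinarith

theorem natKFib.eventually_exists_primitive {K : ℕ} (hK : 0 < K) :
    ∀ᶠ n : ℕ in Filter.atTop, ∃ p, p.Prime ∧ p ∣ natKFib K n ∧
      ∀ j, 0 < j → j < n → ¬ p ∣ natKFib K j := by
  obtain ⟨L, c, C, s, hL, hs0, hs1, hC, hg⟩ := exists_log_natKFib_approx hK
  filter_upwards [eventually_two_mul_log_lt (D := C * (1 - s)⁻¹) hL,
    Filter.eventually_gt_atTop 1] with n hn hn1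
  by_contra! hcon
  have h1 := totient_mul_sub_le_sum_moebius hs0 hs1 hC hg hn1
  have h2 := natKFib.sum_moebius_log_le hK (by omega : 0 < n) hcon
  linarith

/-! ### The shifted sequence and its Zsigmondy set -/

/-- The `K`-Fibonacci sequence, extended to negative indices and read from the index `-r` on. -/
def shiftedKFib (K r n : ℕ) : ℤ :=
  if n ≤ r then (-1) ^ (r + 1 + n) * natKFib K (r - n) else natKFib K (n - r)

theorem shiftedKFib_of_le {K r n : ℕ} (h : n ≤ r) :
    shiftedKFib K r n = (-1) ^ (r + 1 + n) * natKFib K (r - n) := if_pos h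

theorem shiftedKFib_add (K r m : ℕ) : shiftedKFib K r (r + m) = natKFib K m := by
  rcases m with _ | m
  · simp [shiftedKFib, natKFib]
  · simp [shiftedKFib]

theorem shiftedKFib_sub_natAbs {K r m : ℕ} (h : m ≤ r) :
    (shiftedKFib K r (r - m)).natAbs = natKFib K m := by
  rw [shiftedKFib_of_le (Nat.sub_le r m), Nat.sub_sub_self h]
  simp [Int.natAbs_mul]

theorem shiftedKFib_add_two (K r n : ℕ) :
    shiftedKFib K r (n + 2) = K * shiftedKFib K r (n + 1) + shiftedKFib K r n := by
  rcases le_or_gt r n with h | h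
  · obtain ⟨m, rfl⟩ := Nat.exists_eq_add_of_le h
    simp only [add_assoc, shiftedKFib_add, natKFib.add_two]
    push_cast
    ring
  · obtain ⟨m, rfl⟩ := Nat.exists_eq_add_of_lt h
    rcases m with _ | m
    · rw [show n + 2 = (n + 0 + 1) + 1 by ring, shiftedKFib_add,
        shiftedKFib_of_le (by omega), shiftedKFib_of_le (by omega)]
      simp only [add_zero, Nat.sub_self, Nat.add_sub_cancel_left]
      simp [natKFib, show n + 1 + 1 + n = 2 * (n + 1) by ring]
    · rw [shiftedKFib_of_le (by omega), shiftedKFib_of_le (by omega),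
        shiftedKFib_of_le (by omega), show n + (m + 1) + 1 - (n + 2) = m by omega,
        show n + (m + 1) + 1 - (n + 1) = m + 1 by omega,
        show n + (m + 1) + 1 - n = m + 2 by omega, natKFib.add_two]
      push_cast
      ring

theorem cast_shiftedKFib {K r : ℕ} (hr : 1 ≤ r) {a b : ℝ}
    (ha : a = (-1) ^ r * (kFib K (r - 1) + K * kFib K r / 2))
    (hb : b = (-1) ^ (r + 1) * (kFib K r / 2)) (n : ℕ) :
    (shiftedKFib K r n : ℝ) = genFL K a b n := by
  induction n using Nat.twoStepInduction with
  | zero =>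
    rw [shiftedKFib_of_le (Nat.zero_le _), Nat.sub_zero, genFL, hb, ← natKFib.cast_real]
    push_cast
    ring
  | one =>
    rw [shiftedKFib_of_le hr, genFL, hb, ha, ← natKFib.cast_real, ← natKFib.cast_real]
    push_cast
    ring
  | more n h0 h1 =>
    rw [shiftedKFib_add_two, genFL, ← h0, ← h1]
    push_cast
    ring

theorem mem_zsigmondySet_of_dvd {A : ℕ → ℤ} {m n : ℕ} (hmn : m < n) (h0 : A m ≠ 0)
    (h : A n ∣ A m) : n ∈ zsigmondySet A := by
  rintro ⟨p, -, hpn, hp⟩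
  exact hp m hmn h0 (hpn.trans h)

theorem shiftedKFib_ne_zero {K r m : ℕ} (hK : 0 < K) (hm : 0 < m) (h : m ≤ r) :
    shiftedKFib K r (r - m) ≠ 0 := by
  rw [← Int.natAbs_ne_zero, shiftedKFib_sub_natAbs h]
  exact (natKFib.pos_of_pos hK hm).ne'

theorem le_encard_zsigmondySet_shiftedKFib {K r N : ℕ} (hK : 0 < K) (hr : 1 ≤ r)
    (h : N / 2 + 1 ≤ r.divisors.card) :
    (N : ℕ∞) ≤ (zsigmondySet (shiftedKFib K r)).encard := by
  let s : Finset ℕ := r.properDivisors.image (fun d => r - d)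
  let t : Finset ℕ := Finset.Ioc r (r + r)
  have hs : s.card + 1 = r.divisors.card := by
    rw [Finset.card_image_of_injOn, ← Nat.cons_self_properDivisors (by omega : r ≠ 0),
      Finset.card_cons]
    intro a ha b hb hab
    have h1 := (Nat.mem_properDivisors.mp ha).2
    have h2 := (Nat.mem_properDivisors.mp hb).2
    simp only at hab
    omega
  have hst : Disjoint s t := by
    rw [Finset.disjoint_left]
    intro x hx hx'
    obtain ⟨d, -, rfl⟩ := Finset.mem_image.mp hx
    have := (Finset.mem_Ioc.mp hx').1
    omega
  have hcard : N ≤ (s ∪ t).card := by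
    rw [Finset.card_union_of_disjoint hst, Nat.card_Ioc]
    -- The union has `d(r) - 1 + r ≥ 2 d(r) - 1 ≥ N` elements.
    have := Nat.card_divisors_le_self r
    omega
  have hsub : ((s ∪ t : Finset ℕ) : Set ℕ) ⊆ zsigmondySet (shiftedKFib K r) := by
    intro x hx
    rcases Finset.mem_union.mp (Finset.mem_coe.mp hx) with hx | hx
    · obtain ⟨d, hd, rfl⟩ := Finset.mem_image.mp hx
      obtain ⟨hd, hlt⟩ := Nat.mem_properDivisors.mp hd
      refine mem_zsigmondySet_of_dvd (m := r - r) (by omega)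
        (shiftedKFib_ne_zero hK (by omega) le_rfl) ?_
      rw [← Int.natAbs_dvd_natAbs, shiftedKFib_sub_natAbs hlt.le, shiftedKFib_sub_natAbs le_rfl]
      exact natKFib.dvd_of_dvd K hd
    · obtain ⟨h1, h2⟩ := Finset.mem_Ioc.mp hx
      obtain ⟨m, rfl⟩ := Nat.exists_eq_add_of_le h1.le
      refine mem_zsigmondySet_of_dvd (m := r - m) (by omega)
        (shiftedKFib_ne_zero hK (by omega) (by omega)) ?_
      rw [← Int.natAbs_dvd_natAbs, shiftedKFib_sub_natAbs (by omega), shiftedKFib_add,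
        Int.natAbs_natCast]
  calc (N : ℕ∞) ≤ ((s ∪ t).card : ℕ∞) := by exact_mod_cast hcard
    _ = ((s ∪ t : Finset ℕ) : Set ℕ).encard := (Set.encard_coe_eq_coe_finsetCard _).symm
    _ ≤ _ := Set.encard_le_encard hsub

theorem finite_zsigmondySet_shiftedKFib {K : ℕ} (hK : 0 < K) (r : ℕ) :
    (zsigmondySet (shiftedKFib K r)).Finite := by
  obtain ⟨n₀, hn₀⟩ := Filter.eventually_atTop.mp (natKFib.eventually_exists_primitive hK)
  -- The `r + 1` forces `m > r`, so that the mirrored terms `±F_{r-l}` also have Fibonacci index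
  -- below `m`.
  refine (Set.finite_Iio (r + max n₀ (r + 1))).subset fun n hn => ?_
  by_contra hlt
  rw [Set.mem_Iio, not_lt] at hlt
  obtain ⟨m, rfl⟩ := Nat.exists_eq_add_of_le ((Nat.le_add_right r _).trans hlt)
  obtain ⟨p, hp, hpm, hpj⟩ := hn₀ m (by omega)
  refine hn ⟨p, hp, by rw [shiftedKFib_add]; exact_mod_cast hpm, fun l hl hl0 hpl => ?_⟩
  rcases le_or_gt r l with hrl | hrl
  · obtain ⟨j, rfl⟩ := Nat.exists_eq_add_of_le hrl
    rw [shiftedKFib_add] at hl0 hpl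
    refine hpj j (Nat.pos_of_ne_zero ?_) (by omega) (by exact_mod_cast hpl)
    rintro rfl
    simp [natKFib] at hl0
  · refine hpj (r - l) (by omega) (by omega) ?_
    rw [← shiftedKFib_sub_natAbs (Nat.sub_le r l), Nat.sub_sub_self hrl.le]
    exact Int.natCast_dvd.mp hpl

theorem mainTheorem4 (k : ℤ) (hk : 1 ≤ k) :
    (∀ N : ℕ, 1 ≤ N → ∃ a b : ℝ, IsObtainedPair (k : ℝ) N a b) ∧
    ∀ a b : ℕ → ℝ, (∀ N : ℕ, 1 ≤ N → IsObtainedPair (k : ℝ) N (a N) (b N)) →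
      (∀ N : ℕ, 1 ≤ N → ∃ A : ℕ → ℤ, (∀ n, (A n : ℝ) = genFL (k : ℝ) (a N) (b N) n) ∧
        (N : ℕ∞) ≤ (zsigmondySet A).encard) ∧
      (⨆ A ∈ flFamily (k : ℝ) a b, (zsigmondySet A).encard) = ⊤ ∧
      ∀ A ∈ flFamily (k : ℝ) a b, (zsigmondySet A).Finite := by
  lift k to ℕ using by omega
  have hk : 0 < k := by omega
  rw [Int.cast_natCast]
  refine ⟨fun N _ => ⟨_, _, 2 ^ N, Nat.one_le_two_pow, ?_, rfl, rfl⟩, fun a b hab => ?_⟩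
  · rw [Nat.divisors_prime_pow Nat.prime_two, Finset.card_map, Finset.card_range]
    omega
  have key : ∀ N : ℕ, 1 ≤ N → ∃ A : ℕ → ℤ, (∀ n, (A n : ℝ) = genFL k (a N) (b N) n) ∧
      (N : ℕ∞) ≤ (zsigmondySet A).encard ∧ (zsigmondySet A).Finite := fun N hN => by
    obtain ⟨r, hr, hdiv, ha, hb⟩ := hab N hN
    exact ⟨shiftedKFib k r, cast_shiftedKFib hr ha hb,
      le_encard_zsigmondySet_shiftedKFib hk hr hdiv, finite_zsigmondySet_shiftedKFib hk r⟩
  refine ⟨fun N hN => ?_, ?_, ?_⟩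
  · obtain ⟨A, hA, hcard, -⟩ := key N hN
    exact ⟨A, hA, hcard⟩
  · refine ENat.eq_top_iff_forall_ge.mpr fun N => ?_
    obtain ⟨A, hA, hcard, -⟩ := key (N + 1) (by omega)
    exact (Nat.cast_le.mpr N.le_succ).trans (hcard.trans
      (le_iSup₂_of_le (f := fun B (_ : B ∈ flFamily (k : ℝ) a b) => (zsigmondySet B).encard)
        A ⟨N + 1, by omega, hA⟩ le_rfl))
  · rintro B ⟨N, hN, hB⟩
    obtain ⟨A, hA, -, hfin⟩ := key N hN
    have : B = A := funext fun n => by exact_mod_cast (hB n).trans (hA n).symm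
    exact this ▸ hfin
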